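/- Let $t\in\mathbb{R}$ be fixed and let $w(x;t)=e^{-x^6+tx^2}$, $x\in\mathbb{R}$. Let $P_n(x;t)$, $n=0,1,2,\dots$, be the monic polynomials with $\deg P_n=n$ that are orthogonal with respect to $w$, i.e. $\int_{-\infty}^{\infty}P_j(x;t)P_k(x;t)w(x;t)\,dx=0$ for $j\neq k$, and let $\beta_n=\beta_n(t)$ be the coefficients of their three-term recurrence relation $xP_n(x;t)=P_{n+1}(x;t)+\beta_n(t)P_{n-1}(x;t)$ (with $P_0=1$, $\beta_0P_{-1}=0$, $\beta_0=0$). Then, as $n\to\infty$, $$ \begin{aligned} \beta_n(t)={}&\frac{n^{1/3}}{\sqrt[3]{60}}+\frac{t}{3\sqrt[3]{450}\,n^{1/3}}-\frac{4t^3-135}{2430\sqrt[3]{60}\,n^{5/3}}+\frac{t(2t^3-45)}{3645\sqrt[3]{450}\,n^{7/3}}-\frac{2t^2}{1215\,n^3}\\ &-\frac{16t^6-3780t^3+40095}{1476225\sqrt[3]{60}\,n^{11/3}}+\frac{t(16t^6-180t^3-112995)}{3542940\sqrt[3]{450}\,n^{13/3}}+O(n^{-5}), \end{aligned} $$ where the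 implied constant may depend on $t$. -/

import Mathlib

open Polynomial
open scoped Asymptotics

noncomputable section

namespace Freud

/-- The sextic Freud weight `w(x;t) = exp(-x^6 + t x^2)` on the real line. -/
def weight (t x : ℝ) : ℝ := Real.exp (-x ^ 6 + t * x ^ 2)

/-- The pairing `∫ p(x) q(x) w(x;t) dx` over the real line. -/
def pairing (t : ℝ) (p q : ℝ[X]) : ℝ := ∫ x : ℝ, p.eval x * q.eval x * weight t x

/-- `P 0, P 1, …` is the sequence of monic orthogonal polynomials for the weight `w(x;t)`,
`P n` having degree `n`. -/
structure IsMonicOPS (t : ℝ) (P : ℕ → ℝ[X]) : Prop where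
  monic : ∀ n, (P n).Monic
  natDegree_eq : ∀ n, (P n).natDegree = n
  orthogonal : ∀ j k, j ≠ k → pairing t (P j) (P k) = 0

/-- `β` is the sequence of coefficients in `x P_n = P_{n+1} + β_n P_{n-1}`, where the term
`β_0 P_{-1}` is zero and `β_0 = 0`. -/
structure IsRecurrenceCoeff (P : ℕ → ℝ[X]) (β : ℕ → ℝ) : Prop where
  coeff_zero : β 0 = 0
  rec_zero : X * P 0 = P 1
  rec_succ : ∀ n, X * P (n + 1) = P (n + 2) + C (β (n + 1)) * P n

theorem integrable_eval_mul_weight (t : ℝ) (p : ℝ[X]) :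
    MeasureTheory.Integrable (fun x : ℝ => p.eval x * weight t x) := by
  induction p using Polynomial.induction_on' with
  | add p q hp hq =>
    simp only [eval_add, add_mul]
    exact hp.add hq
  | monomial k a =>
    have h1 : MeasureTheory.Integrable (fun x : ℝ => x ^ k * Real.exp (-1 * x ^ 2)) := by
      have := integrable_rpow_mul_exp_neg_mul_sq (b := 1) one_pos (s := (k : ℝ))
        (by have : (0 : ℝ) ≤ k := Nat.cast_nonneg k
            linarith)
      simpa [Real.rpow_natCast] using this
    have h2 := (h1.const_mul a).norm.const_mul (Real.exp ((|t| + 1) ^ 2))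
    refine h2.mono' ?_ ?_
    · unfold weight
      exact Continuous.aestronglyMeasurable (by fun_prop)
    · refine Filter.Eventually.of_forall fun x => ?_
      have hexp : weight t x ≤ Real.exp ((|t| + 1) ^ 2) * Real.exp (-1 * x ^ 2) := by
        rw [← Real.exp_add, weight, Real.exp_le_exp]
        have ht := le_abs_self t
        have h0 := abs_nonneg t
        have hy : 0 ≤ x ^ 2 := sq_nonneg x
        have e6 : x ^ 6 = (x ^ 2) ^ 3 := by ring
        rw [e6]
        generalize x ^ 2 = y at hy
        generalize |t| = s at ht h0
        rcases le_total y (s + 1) with h | h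
        · nlinarith [pow_nonneg hy 3, mul_le_mul_of_nonneg_right ht hy]
        · have h3 : (s + 1) * y ≤ y ^ 3 := by
            have : s + 1 ≤ y ^ 2 := by nlinarith
            nlinarith
          nlinarith [mul_le_mul_of_nonneg_right ht hy, sq_nonneg (s + 1)]
      have hw : 0 ≤ weight t x := (Real.exp_pos _).le
      rw [eval_monomial, norm_mul, norm_mul, norm_mul, norm_mul, Real.norm_of_nonneg hw,
        Real.norm_of_nonneg (Real.exp_pos _).le]
      calc _ ≤ ‖a‖ * ‖x ^ k‖ * (Real.exp ((|t| + 1) ^ 2) * Real.exp (-1 * x ^ 2)) := by gcongr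
        _ = _ := by ring

theorem integrable_pairing (t : ℝ) (p q : ℝ[X]) :
    MeasureTheory.Integrable (fun x : ℝ => p.eval x * q.eval x * weight t x) := by
  simpa using integrable_eval_mul_weight t (p * q)

theorem pairing_comm (t : ℝ) (p q : ℝ[X]) : pairing t p q = pairing t q p := by
  simp only [pairing, mul_comm]

theorem pairing_add_left (t : ℝ) (p q r : ℝ[X]) :
    pairing t (p + q) r = pairing t p r + pairing t q r := by
  rw [pairing, pairing, pairing,
    ← MeasureTheory.integral_add (integrable_pairing t p r) (integrable_pairing t q r)]
  simp only [eval_add, add_mul]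

theorem pairing_C_mul_left (t a : ℝ) (p r : ℝ[X]) :
    pairing t (C a * p) r = a * pairing t p r := by
  rw [pairing, pairing, ← MeasureTheory.integral_const_mul]
  simp only [eval_mul, eval_C, mul_assoc]

theorem pairing_add_right (t : ℝ) (p q r : ℝ[X]) :
    pairing t r (p + q) = pairing t r p + pairing t r q := by
  rw [pairing_comm, pairing_add_left, pairing_comm t p, pairing_comm t q]

theorem pairing_C_mul_right (t a : ℝ) (p r : ℝ[X]) :
    pairing t r (C a * p) = a * pairing t r p := by
  rw [pairing_comm, pairing_C_mul_left, pairing_comm]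

theorem pairing_X_mul (t : ℝ) (p q : ℝ[X]) : pairing t (X * p) q = pairing t p (X * q) := by
  simp only [pairing, eval_mul, eval_X]
  congr 1
  ext x
  ring

theorem pairing_self_pos (t : ℝ) {p : ℝ[X]} (hp : p ≠ 0) : 0 < pairing t p p := by
  obtain ⟨x, hx⟩ : ∃ x, p.eval x ≠ 0 := by
    by_contra! h
    exact hp (Polynomial.funext (by simpa using h))
  refine MeasureTheory.integral_pos_of_integrable_nonneg_nonzero (x := x) ?_
    (integrable_pairing t p p) ?_ ?_
  · unfold weight
    fun_prop
  · intro y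
    exact mul_nonneg (mul_self_nonneg _) (Real.exp_pos _).le
  · exact mul_ne_zero (mul_ne_zero hx hx) (Real.exp_pos _).ne'

/-- Auxiliary construction: the polynomials produced by the three-term recurrence with
`β_n = h_n / h_{n-1}`. -/
def aux (t : ℝ) : ℕ → ℝ[X]
  | 0 => 1
  | 1 => X
  | n + 2 => X * aux t (n + 1) -
      C (pairing t (aux t (n + 1)) (aux t (n + 1)) / pairing t (aux t n) (aux t n)) * aux t n

theorem aux_monic_natDegree (t : ℝ) :
    ∀ n, (aux t n).Monic ∧ (aux t n).natDegree = n := by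
  intro n
  induction n using Nat.twoStepInduction with
  | zero => simp [aux]
  | one => simp [aux, monic_X]
  | more n h0 h1 =>
    rw [aux]
    have hX : (X * aux t (n + 1)).Monic := monic_X.mul h1.1
    have hXd : (X * aux t (n + 1)).natDegree = n + 2 := by
      rw [monic_X.natDegree_mul h1.1, h1.2, natDegree_X]
      ring
    generalize pairing t (aux t (n + 1)) (aux t (n + 1)) / pairing t (aux t n) (aux t n) = b
    have hlt : (C b * aux t n).degree < (X * aux t (n + 1)).degree := by
      rw [degree_eq_natDegree hX.ne_zero, hXd]
      have hle : (C b * aux t n).degree ≤ (n : WithBot ℕ) :=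
        degree_le_of_natDegree_le ((natDegree_C_mul_le _ _).trans h0.2.le)
      refine lt_of_le_of_lt hle ?_
      exact_mod_cast (by omega : n < n + 2)
    refine ⟨hX.sub_of_left hlt, ?_⟩
    rw [natDegree_eq_of_degree_eq (degree_sub_eq_left_of_degree_lt hlt), hXd]

theorem aux_eval_neg (t x : ℝ) :
    ∀ n, (aux t n).eval (-x) = (-1) ^ n * (aux t n).eval x := by
  intro n
  induction n using Nat.twoStepInduction with
  | zero => simp [aux]
  | one => simp [aux]
  | more n h0 h1 =>
    rw [aux]
    simp only [eval_sub, eval_mul, eval_X, eval_C, h0, h1]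
    ring

theorem aux_pairing_X_self (t : ℝ) (n : ℕ) : pairing t (X * aux t n) (aux t n) = 0 := by
  have h := MeasureTheory.integral_neg_eq_self
    (fun x : ℝ => (X * aux t n).eval x * (aux t n).eval x * weight t x) MeasureTheory.volume
  have h2 : ∀ x : ℝ, (X * aux t n).eval (-x) * (aux t n).eval (-x) * weight t (-x) =
      -((X * aux t n).eval x * (aux t n).eval x * weight t x) := by
    intro x
    have hs : ((-1 : ℝ) ^ n) * (-1) ^ n = 1 := by rw [← mul_pow]; norm_num
    have hw : weight t (-x) = weight t x := by
      unfold weight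
      congr 1
      ring
    simp only [eval_mul, eval_X, aux_eval_neg, hw]
    linear_combination (-(x * (aux t n).eval x * (aux t n).eval x * weight t x)) * hs
  simp only [h2, MeasureTheory.integral_neg] at h
  unfold pairing
  linarith

theorem aux_rec (t : ℝ) (n : ℕ) : X * aux t (n + 1) = aux t (n + 2) +
    C (pairing t (aux t (n + 1)) (aux t (n + 1)) / pairing t (aux t n) (aux t n)) * aux t n := by
  rw [aux]
  ring

theorem aux_orth (t : ℝ) : ∀ n k, k < n → pairing t (aux t n) (aux t k) = 0 := by
  intro n
  induction n using Nat.twoStepInduction with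
  | zero => intro k hk; omega
  | one =>
    intro k hk
    obtain rfl : k = 0 := by omega
    simpa [aux] using aux_pairing_X_self t 0
  | more n h0 h1 =>
    intro k hk
    have e : pairing t (aux t (n + 2)) (aux t k) = pairing t (X * aux t (n + 1)) (aux t k) -
        pairing t (aux t (n + 1)) (aux t (n + 1)) / pairing t (aux t n) (aux t n) *
          pairing t (aux t n) (aux t k) := by
      rw [aux_rec, pairing_add_left, pairing_C_mul_left]
      ring
    rw [e]
    rcases (by omega : k = n + 1 ∨ k = n ∨ k < n) with rfl | rfl | hkn
    · rw [aux_pairing_X_self, pairing_comm t (aux t n) (aux t (n + 1)), h1 n (by omega)]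
      ring
    · have hpos := (pairing_self_pos t (aux_monic_natDegree t k).1.ne_zero).ne'
      rw [pairing_X_mul, div_mul_cancel₀ _ hpos]
      cases k with
      | zero => simp [aux]
      | succ m =>
        rw [aux_rec t m, pairing_add_right, pairing_C_mul_right, h1 m (by omega)]
        ring
    · rw [pairing_X_mul, h0 k hkn]
      cases k with
      | zero =>
        have : X * aux t 0 = aux t 1 := by simp [aux]
        rw [this, h1 1 (by omega)]
        ring
      | succ m =>
        rw [aux_rec t m, pairing_add_right, pairing_C_mul_right, h1 m (by omega),
          h1 (m + 2) (by omega)]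
        ring

theorem aux_isMonicOPS (t : ℝ) : IsMonicOPS t (aux t) where
  monic n := (aux_monic_natDegree t n).1
  natDegree_eq n := (aux_monic_natDegree t n).2
  orthogonal j k hjk := by
    rcases lt_or_gt_of_ne hjk with h | h
    · rw [pairing_comm]
      exact aux_orth t k j h
    · exact aux_orth t j k h

theorem IsMonicOPS.pairing_eq_zero {t : ℝ} {P : ℕ → ℝ[X]} (hP : IsMonicOPS t P) (n : ℕ) :
    ∀ m ≤ n, ∀ q : ℝ[X], q.degree < m → pairing t (P n) q = 0 := by
  intro m
  induction m with
  | zero =>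
    intro _ q hq
    have : q = 0 := by simpa [Nat.WithBot.lt_zero_iff] using hq
    simp [this, pairing]
  | succ m ih =>
    intro hm q hq
    have e : q = (q - C (q.coeff m) * P m) + C (q.coeff m) * P m := by ring
    have hdeg : (q - C (q.coeff m) * P m).degree < m := by
      rw [degree_lt_iff_coeff_zero] at hq ⊢
      intro i hi
      rcases Nat.eq_or_lt_of_le hi with rfl | hlt
      · have : (P m).coeff m = 1 := by
          have := hP.monic m
          rwa [Monic, leadingCoeff, hP.natDegree_eq] at this
        simp [this]
      · have : (P m).coeff i = 0 :=
          coeff_eq_zero_of_natDegree_lt (by rw [hP.natDegree_eq]; exact hlt)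
        simp [this, hq i (by omega)]
    rw [e, pairing_add_right, pairing_C_mul_right, ih (by omega) _ hdeg,
      hP.orthogonal n m (by omega)]
    ring

theorem IsMonicOPS.unique {t : ℝ} {P Q : ℕ → ℝ[X]} (hP : IsMonicOPS t P)
    (hQ : IsMonicOPS t Q) : P = Q := by
  funext n
  by_contra hne
  have hd : (P n - Q n).degree < n := by
    have hPd : (P n).degree = n := by
      rw [degree_eq_natDegree (hP.monic n).ne_zero, hP.natDegree_eq]
    have hQd : (Q n).degree = n := by
      rw [degree_eq_natDegree (hQ.monic n).ne_zero, hQ.natDegree_eq]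
    rw [← hPd]
    exact degree_sub_lt_left (hPd.trans hQd.symm) (hP.monic n).ne_zero
      ((hP.monic n).trans (hQ.monic n).symm)
  have h1 := hP.pairing_eq_zero n n le_rfl _ hd
  have h2 := hQ.pairing_eq_zero n n le_rfl _ hd
  have e : P n = (P n - Q n) + Q n := by ring
  have h3 : pairing t (P n) (P n - Q n) =
      pairing t (P n - Q n) (P n - Q n) + pairing t (Q n) (P n - Q n) := by
    rw [← pairing_add_left, ← e]
  have h4 := pairing_self_pos t (sub_ne_zero.mpr hne)
  linarith

theorem existsUnique_isMonicOPS (t : ℝ) : ∃! P : ℕ → ℝ[X], IsMonicOPS t P :=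
  ⟨aux t, aux_isMonicOPS t, fun _ hQ => hQ.unique (aux_isMonicOPS t)⟩

/-- The monic orthogonal polynomials `P_n(x;t)` for the weight `w(x;t)`. -/
def monicOP (t : ℝ) : ℕ → ℝ[X] := (existsUnique_isMonicOPS t).choose

theorem monicOP_isMonicOPS (t : ℝ) : IsMonicOPS t (monicOP t) :=
  (existsUnique_isMonicOPS t).choose_spec.1

theorem existsUnique_isRecurrenceCoeff (t : ℝ) :
    ∃! β : ℕ → ℝ, IsRecurrenceCoeff (monicOP t) β := by
  have hP := monicOP_isMonicOPS t
  have e : monicOP t = aux t := hP.unique (aux_isMonicOPS t)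
  refine ⟨fun n => Nat.casesOn n 0 fun m => pairing t (aux t (m + 1)) (aux t (m + 1)) /
    pairing t (aux t m) (aux t m), ⟨rfl, by rw [e]; simp [aux], fun n => by
      rw [e]; exact aux_rec t n⟩, ?_⟩
  intro β hβ
  funext n
  cases n with
  | zero => exact hβ.coeff_zero
  | succ n =>
    have h1 := hβ.rec_succ n
    rw [e, aux_rec] at h1
    have h2 := mul_right_cancel₀ (aux_monic_natDegree t n).1.ne_zero (add_left_cancel h1)
    exact (C_injective h2).symm

/-- The recurrence coefficients `β_n(t)` of the monic orthogonal polynomials `P_n(x;t)`. -/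
def recurrenceCoeff (t : ℝ) : ℕ → ℝ := (existsUnique_isRecurrenceCoeff t).choose

theorem recurrenceCoeff_isRecurrenceCoeff (t : ℝ) :
    IsRecurrenceCoeff (monicOP t) (recurrenceCoeff t) :=
  (existsUnique_isRecurrenceCoeff t).choose_spec.1

end Freud

end

noncomputable section

/-! ### Integration by parts and the string equation. -/

namespace Freud

/-! The recurrence coefficients satisfy a nonlinear difference equation, and the proof works with
that equation alone, together with positivity. Integrating the derivative of `P_n P_{n-1} w` gives
the string equation (`IsRecurrenceCoeff.string_equation`): a cubic form in five consecutive
coefficients, minus `t β_n / 3`, equals `n / 6`. Divide by `z ^ 3`, where `z = (n / 60) ^ (1 / 3)`.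
The right side becomes `10`, the value of the cubic form at all ones, and the term in `t` becomes
negligible.

Three facts then give the expansion. The first is the leading order: since `stringForm` is monotone
on nonnegative arguments, comparing the limsup and liminf of `β_n / z` forces both to be `1`
(`tendsto_one_of_stringForm`). The second is consistency: the truncated series satisfies the scaled
equation up to `O(w ^ 16)` with `w = 1 / z` (`stringForm_profile_isBigO`).

The third is stability. Subtracting the two equations gives a linear relation among five consecutive
errors, whose coefficients tend to `1, 6, 16, 6, 1` up to the residual. Because `1 + 6 + 6 + 1 = 14
< 16`, the central error is at most a fixed fraction below one of the largest neighbouring error,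
plus `O(w ^ 16)`. Iterating (`isBigO_of_neighbour_contraction`) makes the relative error `O(w ^
16)`, so the absolute error is `O(z w ^ 16) = O(z ^ (-15)) = O(n ^ (-5))`. -/

theorem pairing_derivative (t : ℝ) (p q : ℝ[X]) :
    pairing t (derivative p) q + pairing t p (derivative q) =
      6 * pairing t (X ^ 5 * p) q - 2 * t * pairing t (X * p) q := by
  have hderiv : ∀ x : ℝ, HasDerivAt (fun x => p.eval x * q.eval x * weight t x)
      (((derivative p).eval x * q.eval x * weight t x +
        p.eval x * (derivative q).eval x * weight t x) -
        (6 * ((X ^ 5 * p).eval x * q.eval x * weight t x) -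
          2 * t * ((X * p).eval x * q.eval x * weight t x))) x := by
    intro x
    have hw : HasDerivAt (weight t) (weight t x * (-(6 * x ^ 5) + t * (2 * x))) x := by
      have h1 : HasDerivAt (fun x : ℝ => -x ^ 6 + t * x ^ 2) (-(6 * x ^ 5) + t * (2 * x)) x := by
        refine (((hasDerivAt_pow 6 x).fun_neg).fun_add
          ((hasDerivAt_pow 2 x).const_mul t)).congr_deriv ?_
        norm_num
      exact h1.exp
    refine (((p.hasDerivAt x).fun_mul (q.hasDerivAt x)).fun_mul hw).congr_deriv ?_
    simp only [eval_mul, eval_pow, eval_X]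
    ring
  have i1 := integrable_pairing t (derivative p) q
  have i2 := integrable_pairing t p (derivative q)
  have i3 := (integrable_pairing t (X ^ 5 * p) q).const_mul 6
  have i4 := (integrable_pairing t (X * p) q).const_mul (2 * t)
  -- No boundary terms appear: both `p q w` and its derivative are integrable on the line.
  have h := MeasureTheory.integral_eq_zero_of_hasDerivAt_of_integrable hderiv
    ((i1.add i2).sub (i3.sub i4)) (integrable_pairing t p q)
  have h1 := MeasureTheory.integral_sub (i1.add i2) (i3.sub i4)
  simp only [Pi.add_apply, Pi.sub_apply] at h1
  rw [h1, MeasureTheory.integral_sub i3 i4, MeasureTheory.integral_add i1 i2,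
    MeasureTheory.integral_const_mul, MeasureTheory.integral_const_mul] at h
  simp only [pairing]
  linarith

section Recurrence

variable {t : ℝ} {P : ℕ → ℝ[X]} {β : ℕ → ℝ}

/-- The derivative has leading coefficient `n + 1`; what remains after removing that multiple of `P
n` has degree below `n` and is orthogonal to `P n`. -/
theorem IsMonicOPS.pairing_derivative_succ (hP : IsMonicOPS t P) (n : ℕ) :
    pairing t (derivative (P (n + 1))) (P n) = (n + 1) * pairing t (P n) (P n) := by
  have hd : (derivative (P (n + 1)) - C ((n : ℝ) + 1) * P n).degree < n := by
    rw [degree_lt_iff_coeff_zero]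
    intro i hi
    rw [coeff_sub, coeff_C_mul, coeff_derivative]
    rcases Nat.eq_or_lt_of_le hi with rfl | hlt
    · have h1 : ∀ m, (P m).coeff m = 1 := fun m => by
        have := hP.monic m
        rwa [Monic, leadingCoeff, hP.natDegree_eq] at this
      rw [h1, h1]
      ring
    · rw [coeff_eq_zero_of_natDegree_lt (by rw [hP.natDegree_eq]; omega),
        coeff_eq_zero_of_natDegree_lt (by rw [hP.natDegree_eq]; omega)]
      ring
  have h0 := hP.pairing_eq_zero n n le_rfl _ hd
  have e : derivative (P (n + 1)) =
      (derivative (P (n + 1)) - C ((n : ℝ) + 1) * P n) + C ((n : ℝ) + 1) * P n := by ring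
  rw [e, pairing_add_left, pairing_C_mul_left, pairing_comm, h0, zero_add]

theorem IsMonicOPS.pairing_succ_derivative (hP : IsMonicOPS t P) (n : ℕ) :
    pairing t (P (n + 1)) (derivative (P n)) = 0 := by
  refine hP.pairing_eq_zero (n + 1) (n + 1) le_rfl _ ?_
  refine lt_of_le_of_lt (degree_derivative_le) ?_
  rw [degree_eq_natDegree (hP.monic n).ne_zero, hP.natDegree_eq]
  exact_mod_cast Nat.lt_succ_self n

theorem IsRecurrenceCoeff.pairing_X_mul_succ (hP : IsMonicOPS t P) (hβ : IsRecurrenceCoeff P β)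
    (n : ℕ) : pairing t (X * P (n + 1)) (P n) = β (n + 1) * pairing t (P n) (P n) := by
  rw [hβ.rec_succ, pairing_add_left, pairing_C_mul_left, hP.orthogonal _ _ (by omega), zero_add]

theorem IsRecurrenceCoeff.pairing_self_succ (hP : IsMonicOPS t P) (hβ : IsRecurrenceCoeff P β)
    (n : ℕ) : pairing t (P (n + 1)) (P (n + 1)) = β (n + 1) * pairing t (P n) (P n) := by
  rw [← hβ.pairing_X_mul_succ hP, pairing_X_mul]
  cases n with
  | zero => rw [hβ.rec_zero]
  | succ m =>
    rw [hβ.rec_succ, pairing_add_right, pairing_C_mul_right, hP.orthogonal (m + 2) m (by omega)]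
    ring

theorem IsRecurrenceCoeff.succ_pos (hP : IsMonicOPS t P) (hβ : IsRecurrenceCoeff P β)
    (n : ℕ) : 0 < β (n + 1) := by
  have h1 := pairing_self_pos t (hP.monic n).ne_zero
  have h2 := pairing_self_pos t (hP.monic (n + 1)).ne_zero
  rw [hβ.pairing_self_succ hP] at h2
  exact pos_of_mul_pos_left h2 h1.le

/-- The string equation (a member of the discrete Painlevé I hierarchy) for the sextic
Freud weight. -/
theorem IsRecurrenceCoeff.string_equation (hP : IsMonicOPS t P) (hβ : IsRecurrenceCoeff P β)
    (k : ℕ) : β (k + 3) * (6 * (β (k + 4) * (β (k + 5) + β (k + 4) + β (k + 3)) +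
      (β (k + 4) + β (k + 3) + β (k + 2)) * (β (k + 3) + β (k + 2)) +
      β (k + 2) * β (k + 1)) - 2 * t) = k + 3 := by
  have r0 := hβ.rec_succ k
  have r1 := hβ.rec_succ (k + 1)
  have r2 := hβ.rec_succ (k + 2)
  have r3 := hβ.rec_succ (k + 3)
  have r4 := hβ.rec_succ (k + 4)
  have hpos := pairing_self_pos t (hP.monic (k + 2)).ne_zero
  -- The factor `X ^ 5` is shared as `X ^ 3` on one side and `X ^ 2` on the other, so that neither
  -- expansion goes below `P k`; they overlap only in `P (k + 4)`, `P (k + 2)` and `P k`.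
  have e1 : X ^ 3 * P (k + 3) = P (k + 6) + (C (β (k + 5) + β (k + 4) + β (k + 3)) * P (k + 4) +
      (C (β (k + 3) * (β (k + 4) + β (k + 3) + β (k + 2))) * P (k + 2) +
        C (β (k + 3) * β (k + 2) * β (k + 1)) * P k)) := by
    simp only [map_add, map_mul]
    linear_combination X ^ 2 * r2 + X * r3 + r4 + (C (β (k + 4)) + C (β (k + 3))) * r2 +
      X * C (β (k + 3)) * r1 + C (β (k + 3)) * C (β (k + 2)) * r0
  have e2 : X ^ 2 * P (k + 2) = P (k + 4) + (C (β (k + 3) + β (k + 2)) * P (k + 2) +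
      C (β (k + 2) * β (k + 1)) * P k) := by
    simp only [map_add, map_mul]
    linear_combination X * r1 + r2 + C (β (k + 2)) * r0
  have o : ∀ i j, i ≠ j → pairing t (P i) (P j) = 0 := hP.orthogonal
  have e3 : pairing t (X ^ 5 * P (k + 3)) (P (k + 2)) =
      pairing t (X ^ 3 * P (k + 3)) (X ^ 2 * P (k + 2)) := by
    simp only [pairing, eval_mul, eval_pow, eval_X]
    congr 1
    ext x
    ring
  have h := pairing_derivative t (P (k + 3)) (P (k + 2))
  rw [hP.pairing_derivative_succ (k + 2), hP.pairing_succ_derivative (k + 2), e3, e1, e2,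
    hβ.pairing_X_mul_succ hP (k + 2)] at h
  simp only [pairing_add_left, pairing_add_right, pairing_C_mul_left, pairing_C_mul_right] at h
  rw [o (k + 6) (k + 4) (by omega), o (k + 6) (k + 2) (by omega), o (k + 6) k (by omega),
    o (k + 4) (k + 2) (by omega), o (k + 4) k (by omega), o (k + 2) (k + 4) (by omega),
    o (k + 2) k (by omega), o k (k + 4) (by omega), o k (k + 2) (by omega)] at h
  have s0 := hβ.pairing_self_succ hP k
  have s1 := hβ.pairing_self_succ hP (k + 1)
  have s2 := hβ.pairing_self_succ hP (k + 2)
  have s3 := hβ.pairing_self_succ hP (k + 3)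
  simp only [add_assoc, Nat.reduceAdd] at s0 s1 s2 s3 h
  refine mul_right_cancel₀ hpos.ne' ?_
  push_cast at h
  rw [s3, s2] at h
  have s01 : pairing t (P (k + 2)) (P (k + 2)) =
    β (k + 2) * β (k + 1) * pairing t (P k) (P k) := by rw [s1, s0]; ring
  linear_combination -h + 6 * β (k + 3) * β (k + 2) * β (k + 1) * s01

end Recurrence

/-! ### Leading-order asymptotics by comparing limsup and liminf. -/

open Filter Topology

/-- The cubic form in five consecutive recurrence coefficients that occurs in the string
equation of the sextic weight. -/
def stringForm (a b m d e : ℝ) : ℝ :=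
  m * (a * b + b ^ 2 + 2 * b * m + b * d + m ^ 2 + 2 * m * d + d ^ 2 + d * e)

theorem stringForm_mono {a b m d e a' b' m' d' e' : ℝ} (ha : 0 ≤ a) (hb : 0 ≤ b) (hm : 0 ≤ m)
    (hd : 0 ≤ d) (he : 0 ≤ e) (ha' : a ≤ a') (hb' : b ≤ b') (hm' : m ≤ m') (hd' : d ≤ d')
    (he' : e ≤ e') : stringForm a b m d e ≤ stringForm a' b' m' d' e' := by
  have := ha.trans ha'
  have := hb.trans hb'
  have := hm.trans hm'
  have := hd.trans hd'
  have := he.trans he'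
  unfold stringForm
  gcongr

/-- The difference of the two values of the form factors as `(A - a) * (A ^ 2 + a ^ 2)`, so the
hypotheses force `A = a`; then both read `10 * A ^ 3 = 10`. -/
theorem eq_one_of_stringForm_le {a A : ℝ} (ha : 0 ≤ a) (hA : a ≤ A)
    (h1 : stringForm a a A a a ≤ 10) (h2 : 10 ≤ stringForm A A a A A) : a = 1 ∧ A = 1 := by
  have h3 : (A - a) * (A ^ 2 + a ^ 2) ≤ 0 := by
    unfold stringForm at h1 h2
    nlinarith
  have hAa : A = a := by
    rcases eq_or_lt_of_le hA with h | h
    · exact h.symm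
    · have : 0 < A ^ 2 := by have : 0 < A := ha.trans_lt h
                             positivity
      nlinarith [sq_nonneg a, mul_pos (sub_pos.2 h) this]
  subst hAa
  have h4 : A ^ 3 = 1 := by
    unfold stringForm at h1 h2
    nlinarith
  have : A = 1 := by
    rw [← one_pow 3] at h4
    exact (pow_left_inj₀ ha zero_le_one (by norm_num)).1 h4
  exact ⟨this, this⟩

/-- A positive sequence satisfying an asymptotically homogeneous string equation tends to `1`. -/
theorem tendsto_one_of_stringForm {y η σ₁ σ₂ σ₄ σ₅ : ℕ → ℝ} (hy : ∀ n, 0 ≤ y n)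
    (hη : Tendsto η atTop (𝓝 0)) (h₁ : Tendsto σ₁ atTop (𝓝 1)) (h₂ : Tendsto σ₂ atTop (𝓝 1))
    (h₄ : Tendsto σ₄ atTop (𝓝 1)) (h₅ : Tendsto σ₅ atTop (𝓝 1))
    (hs : ∀ k, stringForm (y (k + 1) * σ₁ k) (y (k + 2) * σ₂ k) (y (k + 3)) (y (k + 4) * σ₄ k)
      (y (k + 5) * σ₅ k) - η k * y (k + 3) = 10) :
    Tendsto y atTop (𝓝 1) := by
  have shift : ∀ {p : ℕ → Prop} (j : ℕ), (∀ᶠ n in atTop, p n) → ∀ᶠ k in atTop, p (k + j) :=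
    fun j h => (tendsto_add_atTop_nat j).eventually h
  -- Dropping the neighbours leaves `y ^ 3 - η y ≤ 10` with `η < 1`, which fails for `y > 3`.
  have hbd : ∀ᶠ n in atTop, y n ≤ 3 := by
    have : ∀ᶠ k in atTop, y (k + 3) ≤ 3 := by
      filter_upwards [hη.eventually (gt_mem_nhds one_pos), h₁.eventually (lt_mem_nhds one_pos),
        h₂.eventually (lt_mem_nhds one_pos), h₄.eventually (lt_mem_nhds one_pos),
        h₅.eventually (lt_mem_nhds one_pos)] with k e0 e1 e2 e4 e5
      have h := stringForm_mono le_rfl le_rfl (hy (k + 3)) le_rfl le_rfl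
        (mul_nonneg (hy (k + 1)) e1.le) (mul_nonneg (hy (k + 2)) e2.le) le_rfl
        (mul_nonneg (hy (k + 4)) e4.le) (mul_nonneg (hy (k + 5)) e5.le)
      have h' := hs k
      have e : stringForm 0 0 (y (k + 3)) 0 0 = y (k + 3) ^ 3 := by unfold stringForm; ring
      rw [e] at h
      have hy3 := hy (k + 3)
      by_contra! hlt
      nlinarith [mul_le_mul_of_nonneg_right e0.le hy3, mul_pos (sub_pos.2 hlt) (sub_pos.2 hlt)]
    rw [← map_add_atTop_eq_nat 3]
    exact this
  have bU : IsBoundedUnder (· ≤ ·) atTop y := isBoundedUnder_of_eventually_le hbd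
  have bL : IsBoundedUnder (· ≥ ·) atTop y :=
    isBoundedUnder_of_eventually_ge (Eventually.of_forall hy)
  set A := limsup y atTop with hAdef
  set a := liminf y atTop with hadef
  have ha0 : 0 ≤ a := le_liminf_of_le bU.isCoboundedUnder_ge (Eventually.of_forall hy)
  have haA : a ≤ A := liminf_le_limsup bU bL
  have near : ∀ {δ : ℝ} (j : ℕ) {σ : ℕ → ℝ}, Tendsto σ atTop (𝓝 1) → 0 < δ →
      ∀ᶠ k in atTop, max (a - δ) 0 ≤ y (k + j) * σ k ∧ y (k + j) * σ k ≤ A + δ := by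
    intro δ j σ hσ hδ
    have hU := shift j (eventually_lt_of_limsup_lt (show A < A + δ / 2 by linarith) bU)
    have hL := shift j (eventually_lt_of_lt_liminf (show a - δ / 2 < a by linarith) bL)
    have hσ' : ∀ᶠ k in atTop, |σ k - 1| < δ / 6 := by
      have := hσ.eventually (Metric.ball_mem_nhds 1 (show 0 < δ / 6 by linarith))
      simpa [Real.dist_eq] using this
    filter_upwards [hU, hL, hσ', shift j hbd, hσ.eventually (lt_mem_nhds one_pos)]
      with k h1 h2 h3 h4 h5
    have hyk := hy (k + j)
    have h6 : |y (k + j) * σ k - y (k + j)| ≤ δ / 2 := by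
      rw [show y (k + j) * σ k - y (k + j) = y (k + j) * (σ k - 1) by ring, abs_mul,
        abs_of_nonneg hyk]
      calc _ ≤ 3 * (δ / 6) := by gcongr
        _ = _ := by ring
    rw [abs_le] at h6
    exact ⟨max_le (by linarith) (mul_nonneg hyk h5.le), by linarith⟩
  have small : ∀ {δ : ℝ}, 0 < δ → ∀ᶠ k in atTop, |η k * y (k + 3)| ≤ δ := by
    intro δ hδ
    have : ∀ᶠ k in atTop, |η k| < δ / 3 := by
      have := hη.eventually (Metric.ball_mem_nhds 0 (show 0 < δ / 3 by linarith))
      simpa [Real.dist_eq] using this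
    filter_upwards [this, shift 3 hbd] with k h1 h2
    rw [abs_mul, abs_of_nonneg (hy (k + 3))]
    calc _ ≤ δ / 3 * 3 := by gcongr
                             exact hy _
      _ = _ := by ring
  -- Evaluate at indices whose central value is close to the limsup, while the neighbours are only
  -- known to be at least about the liminf. Clipping at `0` keeps the arguments in the range where
  -- the form is monotone.
  have lower : ∀ δ : ℝ, 0 < δ → stringForm (max (a - δ) 0) (max (a - δ) 0) (max (A - δ) 0)
      (max (a - δ) 0) (max (a - δ) 0) ≤ 10 + δ := by
    intro δ hδ
    have hf : ∃ᶠ n in atTop, A - δ < y n :=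
      frequently_lt_of_lt_limsup bL.isCoboundedUnder_le (by linarith)
    rw [← map_add_atTop_eq_nat 3, frequently_map] at hf
    obtain ⟨k, hk, n1, n2, n4, n5, ns⟩ := (hf.and_eventually ((near 1 h₁ hδ).and
      ((near 2 h₂ hδ).and ((near 4 h₄ hδ).and ((near 5 h₅ hδ).and (small hδ)))))).exists
    have h := stringForm_mono (le_max_right _ _) (le_max_right _ _) (le_max_right _ _)
      (le_max_right _ _) (le_max_right _ _) n1.1 n2.1 (max_le hk.le (hy (k + 3))) n4.1 n5.1
    linarith [hs k, (abs_le.1 ns).2]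
  have upper : ∀ δ : ℝ, 0 < δ →
      10 - δ ≤ stringForm (A + δ) (A + δ) (a + δ) (A + δ) (A + δ) := by
    intro δ hδ
    have hf : ∃ᶠ n in atTop, y n < a + δ :=
      frequently_lt_of_liminf_lt bU.isCoboundedUnder_ge (by linarith)
    rw [← map_add_atTop_eq_nat 3, frequently_map] at hf
    obtain ⟨k, hk, n1, n2, n4, n5, ns⟩ := (hf.and_eventually ((near 1 h₁ hδ).and
      ((near 2 h₂ hδ).and ((near 4 h₄ hδ).and ((near 5 h₅ hδ).and (small hδ)))))).exists
    have pos : ∀ {x : ℝ}, max (a - δ) 0 ≤ x → 0 ≤ x := fun h => (le_max_right _ _).trans h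
    have h := stringForm_mono (pos n1.1) (pos n2.1) (hy (k + 3)) (pos n4.1) (pos n5.1)
      n1.2 n2.2 hk.le n4.2 n5.2
    linarith [hs k, (abs_le.1 ns).1]
  have L1 : stringForm a a A a a ≤ 10 := by
    have c : Continuous fun δ : ℝ => 10 + δ - stringForm (max (a - δ) 0) (max (a - δ) 0)
        (max (A - δ) 0) (max (a - δ) 0) (max (a - δ) 0) := by
      unfold stringForm
      fun_prop
    have := ge_of_tendsto (c.tendsto 0 |>.mono_left (nhdsWithin_le_nhds (s := Set.Ioi 0)))
      (b := 0) (by filter_upwards [self_mem_nhdsWithin] with δ hδ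
                   linarith [lower δ hδ])
    simp only [sub_zero, max_eq_left ha0, max_eq_left (ha0.trans haA)] at this
    linarith
  have L2 : 10 ≤ stringForm A A a A A := by
    have c : Continuous fun δ : ℝ =>
        stringForm (A + δ) (A + δ) (a + δ) (A + δ) (A + δ) - (10 - δ) := by
      unfold stringForm
      fun_prop
    have := ge_of_tendsto (c.tendsto 0 |>.mono_left (nhdsWithin_le_nhds (s := Set.Ioi 0)))
      (b := 0) (by filter_upwards [self_mem_nhdsWithin] with δ hδ
                   linarith [upper δ hδ])
    simp only [add_zero, sub_zero] at this
    linarith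
  obtain ⟨h1, h2⟩ := eq_one_of_stringForm_le ha0 haA L1 L2
  exact tendsto_of_liminf_eq_limsup h1 h2 bU bL

/-! ### Stability: iterating a contraction over neighbours. -/

/-- If a nonnegative bounded sequence is, up to an error of order `g`, at most `q < 1` times the
maximum of its neighbours at distance at most two, then it is of order `g`. -/
theorem isBigO_of_neighbour_contraction {ε g : ℕ → ℝ} {N : ℕ} {B Cg q θ : ℝ} (hq : 0 ≤ q)
    (hθ : q * θ < 1) (hC : 0 ≤ Cg) (hε : ∀ n, 0 ≤ ε n) (hB : ∀ n ≥ N, ε n ≤ B)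
    (hg : ∀ n ≥ N, 0 < g n) (hq1 : q < 1)
    (hgθ : ∀ k ≥ N, g (k + 1) ≤ θ * g (k + 3) ∧ g (k + 2) ≤ θ * g (k + 3) ∧
      g (k + 4) ≤ θ * g (k + 3) ∧ g (k + 5) ≤ θ * g (k + 3))
    (hstep : ∀ k ≥ N, ∀ M, ε (k + 1) ≤ M → ε (k + 2) ≤ M → ε (k + 4) ≤ M → ε (k + 5) ≤ M →
      ε (k + 3) ≤ q * M + Cg * g (k + 3)) :
    ε =O[atTop] g := by
  have hB0 : 0 ≤ B := (hε N).trans (hB N le_rfl)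
  -- `K` must cover the three initial indices, which `hstep` never reaches, and be stable under `K ↦
  -- q * θ * K + Cg`.
  obtain ⟨K, hK0, hK1, hK2, hK3, hKC⟩ : ∃ K : ℝ, 0 ≤ K ∧ ε N ≤ K * g N ∧
      ε (N + 1) ≤ K * g (N + 1) ∧ ε (N + 2) ≤ K * g (N + 2) ∧ q * θ * K + Cg ≤ K := by
    have h0 := hg N le_rfl
    have h1 := hg (N + 1) (by omega)
    have h2 := hg (N + 2) (by omega)
    have e0 := div_nonneg (hε N) h0.le
    have e1 := div_nonneg (hε (N + 1)) h1.le
    have e2 := div_nonneg (hε (N + 2)) h2.le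
    have e3 : 0 ≤ Cg / (1 - q * θ) := div_nonneg hC (by linarith)
    refine ⟨ε N / g N + ε (N + 1) / g (N + 1) + ε (N + 2) / g (N + 2) + Cg / (1 - q * θ),
      by positivity, ?_, ?_, ?_, ?_⟩
    · rw [← div_le_iff₀ h0]; linarith
    · rw [← div_le_iff₀ h1]; linarith
    · rw [← div_le_iff₀ h2]; linarith
    · have : Cg / (1 - q * θ) * (1 - q * θ) = Cg := div_mul_cancel₀ _ (by linarith)
      nlinarith [mul_nonneg (add_nonneg (add_nonneg e0 e1) e2) (show 0 ≤ 1 - q * θ by linarith)]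
  -- Neighbours lie on both sides, so induction on `n` is unavailable. The induction is on the
  -- number of passes, uniformly in `n`; each pass shrinks the a priori bound `B` by `q`.
  have main : ∀ i : ℕ, ∀ n ≥ N, ε n ≤ K * g n + q ^ i * B := by
    intro i
    induction i with
    | zero =>
      intro n hn
      have := hB n hn
      have := mul_nonneg hK0 (hg n hn).le
      simp only [pow_zero, one_mul]
      linarith
    | succ i ih =>
      intro n hn
      have hqB : 0 ≤ q ^ (i + 1) * B := by positivity
      have hcases : n = N ∨ n = N + 1 ∨ n = N + 2 ∨ ∃ k ≥ N, n = k + 3 := by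
        rcases lt_or_ge n (N + 3) with h | h
        · omega
        · exact Or.inr (Or.inr (Or.inr ⟨n - 3, by omega, by omega⟩))
      rcases hcases with rfl | rfl | rfl | ⟨k, hk, rfl⟩
      · linarith
      · linarith
      · linarith
      obtain ⟨g1, g2, g4, g5⟩ := hgθ k hk
      have hM : ∀ j, N ≤ k + j → g (k + j) ≤ θ * g (k + 3) →
          ε (k + j) ≤ K * (θ * g (k + 3)) + q ^ i * B := fun j hj h =>
        (ih (k + j) hj).trans (by gcongr)
      have h := hstep k hk _ (hM 1 (by omega) g1) (hM 2 (by omega) g2) (hM 4 (by omega) g4)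
        (hM 5 (by omega) g5)
      have := mul_le_mul_of_nonneg_right hKC (hg (k + 3) (by omega)).le
      calc ε (k + 3) ≤ _ := h
        _ = (q * θ * K + Cg) * g (k + 3) + q ^ (i + 1) * B := by ring
        _ ≤ _ := by linarith
  refine Asymptotics.IsBigO.of_bound K ?_
  filter_upwards [eventually_ge_atTop N] with n hn
  rw [Real.norm_of_nonneg (hε n), Real.norm_of_nonneg (hg n hn).le]
  have hlim : Tendsto (fun i : ℕ => K * g n + q ^ i * B) atTop (𝓝 (K * g n + 0 * B)) :=
    ((tendsto_pow_atTop_nhds_zero_of_lt_one hq hq1).mul_const B).const_add _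
  have := ge_of_tendsto' hlim (fun i => main i n hn)
  linarith

/-! ### Consistency: the residual of the truncated series in the scaled string equation. -/

theorem ring_choose_succ (a : ℝ) (n : ℕ) :
    Ring.choose a (n + 1) = Ring.choose a n * (a - n) / (n + 1) := by
  have hn : ((n : ℝ) + 1) ≠ 0 := by positivity
  rw [Ring.choose_eq_smul, Ring.choose_eq_smul, descPochhammer_succ_right, Polynomial.smeval_mul,
    Nat.factorial_succ]
  simp [Polynomial.smeval_sub, Polynomial.smeval_natCast]
  field_simp

theorem one_add_rpow_sub_isBigO (a : ℝ) (n : ℕ) :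
    (fun u : ℝ => (1 + u) ^ a - ∑ i ∈ Finset.range n, Ring.choose a i * u ^ i)
      =O[𝓝 0] fun u => u ^ n := by
  have h := (Real.one_add_rpow_hasFPowerSeriesAt_zero (a := a)).isBigO_sub_partialSum_pow n
  simp only [zero_add, FormalMultilinearSeries.partialSum, binomialSeries_apply,
    List.ofFn_const, List.prod_replicate, smul_eq_mul] at h
  exact h.trans (Asymptotics.isBigO_of_le _ fun u => by simp)

/-- The rescaled approximant: with `n = 60 / w ^ 3`, the truncated asymptotic series at
`n (1 + u)`, divided by its leading factor `1 / w`. -/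
def profile (t w u : ℝ) : ℝ :=
  (1 + u) ^ (1 / 3 : ℝ) + t / 90 * w ^ 2 * (1 + u) ^ (-(1 / 3) : ℝ)
    + (1 / 64800 - t ^ 3 / 2187000) * w ^ 6 * (1 + u) ^ (-(5 / 3) : ℝ)
    + (t ^ 4 / 196830000 - t / 8748000) * w ^ 8 * (1 + u) ^ (-(7 / 3) : ℝ)
    + (-t ^ 2 / 131220000) * w ^ 10 * (1 + u) ^ (-3 : ℝ)
    + (-t ^ 6 / 1195742250000 + 7 * t ^ 3 / 35429400000 - 11 / 5248800000) * w ^ 12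
        * (1 + u) ^ (-(11 / 3) : ℝ)
    + (t ^ 7 / 86093442000000 - t ^ 4 / 7652750400000 - 31 * t / 377913600000) * w ^ 14
        * (1 + u) ^ (-(13 / 3) : ℝ)

/-- The expansion of `profile t w u` in powers of `u`, up to terms of order `w ^ 16` when
`u` is of order `w ^ 3`. -/
def profileTaylor (t w u : ℝ) : ℝ :=
  (1 + u / 3 - u ^ 2 / 9 + 5 * u ^ 3 / 81 - 10 * u ^ 4 / 243 + 22 * u ^ 5 / 729)
    + t / 90 * w ^ 2 * (1 - u / 3 + 2 * u ^ 2 / 9 - 14 * u ^ 3 / 81 + 35 * u ^ 4 / 243)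
    + (1 / 64800 - t ^ 3 / 2187000) * w ^ 6 * (1 - 5 * u / 3 + 20 * u ^ 2 / 9 - 220 * u ^ 3 / 81)
    + (t ^ 4 / 196830000 - t / 8748000) * w ^ 8 * (1 - 7 * u / 3 + 35 * u ^ 2 / 9)
    + (-t ^ 2 / 131220000) * w ^ 10 * (1 - 3 * u)
    + (-t ^ 6 / 1195742250000 + 7 * t ^ 3 / 35429400000 - 11 / 5248800000) * w ^ 12
        * (1 - 11 * u / 3)
    + (t ^ 7 / 86093442000000 - t ^ 4 / 7652750400000 - 31 * t / 377913600000) * w ^ 14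

theorem profile_sub_taylor_isBigO (t j : ℝ) :
    (fun w : ℝ => profile t w (j * w ^ 3 / 60) - profileTaylor t w (j * w ^ 3 / 60))
      =O[𝓝 0] fun w => w ^ 16 := by
  have hu : Tendsto (fun w : ℝ => j * w ^ 3 / 60) (𝓝 0) (𝓝 0) := by
    have : Continuous fun w : ℝ => j * w ^ 3 / 60 := by fun_prop
    simpa using this.tendsto 0
  -- A term with prefactor `w ^ p` and `n` binomial terms kept leaves an error of order `w ^ (p + 3
  -- * n)`, because `u` is of order `w ^ 3`; `m` is the surplus over `16`.
  have key : ∀ (c a : ℝ) (p n m : ℕ), 16 + m = p + 3 * n →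
      (fun w : ℝ => c * w ^ p * ((1 + j * w ^ 3 / 60) ^ a -
        ∑ i ∈ Finset.range n, Ring.choose a i * (j * w ^ 3 / 60) ^ i)) =O[𝓝 0]
        fun w => w ^ 16 := by
    intro c a p n m hm
    have h1 := (one_add_rpow_sub_isBigO a n).comp_tendsto hu
    have h2 : (fun w : ℝ => c * w ^ p) =O[𝓝 0] fun w => w ^ p :=
      Asymptotics.isBigO_const_mul_self _ _ _
    refine (h2.mul h1).trans ?_
    have h3 : (fun w : ℝ => (j / 60) ^ n * w ^ m) =O[𝓝 0] fun _ => (1 : ℝ) := by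
      have : Continuous fun w : ℝ => (j / 60) ^ n * w ^ m := by fun_prop
      exact (this.tendsto 0).isBigO_one ℝ
    refine ((Asymptotics.isBigO_refl (fun w : ℝ => w ^ 16) (𝓝 0)).mul h3).congr ?_ ?_
    · intro w
      simp only [Function.comp_apply]
      calc w ^ 16 * ((j / 60) ^ n * w ^ m) = (j / 60) ^ n * w ^ (16 + m) := by ring
        _ = _ := by rw [hm]; ring
    · intro w
      ring
  have k0 := key 1 (1 / 3) 0 6 2 rfl
  have k1 := key (t / 90) (-(1 / 3)) 2 5 1 rfl
  have k2 := key (1 / 64800 - t ^ 3 / 2187000) (-(5 / 3)) 6 4 2 rfl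
  have k3 := key (t ^ 4 / 196830000 - t / 8748000) (-(7 / 3)) 8 3 1 rfl
  have k4 := key (-t ^ 2 / 131220000) (-3) 10 2 0 rfl
  have k5 := key (-t ^ 6 / 1195742250000 + 7 * t ^ 3 / 35429400000 - 11 / 5248800000)
    (-(11 / 3)) 12 2 2 rfl
  have k6 := key (t ^ 7 / 86093442000000 - t ^ 4 / 7652750400000 - 31 * t / 377913600000)
    (-(13 / 3)) 14 1 1 rfl
  refine ((((((k0.add k1).add k2).add k3).add k4).add k5).add k6).congr_left fun w => ?_
  simp only [Finset.sum_range_succ, Finset.sum_range_zero, ring_choose_succ,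
    Ring.choose_zero_right, profile, profileTaylor]
  push_cast
  ring

/-- An exact linearization, used both to pass from `profileTaylor` to `profile` and to compare `β`
with the series. With all entries equal to `1` the five coefficients are `1, 6, 16, 6, 1`. -/
theorem stringForm_sub (a b m d e a' b' m' d' e' : ℝ) :
    stringForm a b m d e - stringForm a' b' m' d' e' =
      m * b * (a - a') + m * (a' + b + b' + 2 * m + d) * (b - b') +
      (a' * b' + b' ^ 2 + b' * d' + d' ^ 2 + d' * e' + 2 * (b' + d') * (m + m') +
        m ^ 2 + m * m' + m' ^ 2) * (m - m') +
      m * (b' + 2 * m + d + d' + e) * (d - d') + m * d' * (e - e') := by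
  unfold stringForm
  ring

/-- The part of `profileTaylor t w u` that is even in `u`. -/
def profileEven (t w u : ℝ) : ℝ :=
  (1 - u ^ 2 / 9 - 10 * u ^ 4 / 243)
    + t / 90 * w ^ 2 * (1 + 2 * u ^ 2 / 9 + 35 * u ^ 4 / 243)
    + (1 / 64800 - t ^ 3 / 2187000) * w ^ 6 * (1 + 20 * u ^ 2 / 9)
    + (t ^ 4 / 196830000 - t / 8748000) * w ^ 8 * (1 + 35 * u ^ 2 / 9)
    + (-t ^ 2 / 131220000) * w ^ 10
    + (-t ^ 6 / 1195742250000 + 7 * t ^ 3 / 35429400000 - 11 / 5248800000) * w ^ 12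
    + (t ^ 7 / 86093442000000 - t ^ 4 / 7652750400000 - 31 * t / 377913600000) * w ^ 14

/-- The part of `profileTaylor t w u` that is odd in `u`. -/
def profileOdd (t w u : ℝ) : ℝ :=
  (u / 3 + 5 * u ^ 3 / 81 + 22 * u ^ 5 / 729)
    - t / 90 * w ^ 2 * (u / 3 + 14 * u ^ 3 / 81)
    - (1 / 64800 - t ^ 3 / 2187000) * w ^ 6 * (5 * u / 3 + 220 * u ^ 3 / 81)
    - (t ^ 4 / 196830000 - t / 8748000) * w ^ 8 * (7 * u / 3)
    - (-t ^ 2 / 131220000) * w ^ 10 * (3 * u)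
    - (-t ^ 6 / 1195742250000 + 7 * t ^ 3 / 35429400000 - 11 / 5248800000) * w ^ 12
        * (11 * u / 3)

theorem profileTaylor_eq (t w u : ℝ) :
    profileTaylor t w u = profileEven t w u + profileOdd t w u := by
  unfold profileTaylor profileEven profileOdd
  ring

theorem profileTaylor_neg (t w u : ℝ) :
    profileTaylor t w (-u) = profileEven t w u - profileOdd t w u := by
  unfold profileTaylor profileEven profileOdd
  ring

/-- The shifts `±1`, `±2` differ only in the sign of the odd part. Cancelling these parts beforehand
shortens the polynomial expansion in `exists_stringForm_profileTaylor_eq`. -/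
theorem stringForm_symmetric (e₁ o₁ e₂ o₂ m : ℝ) :
    stringForm (e₂ - o₂) (e₁ - o₁) m (e₁ + o₁) (e₂ + o₂) =
      m * (2 * (e₁ * e₂ + o₁ * o₂) + 3 * e₁ ^ 2 + o₁ ^ 2 + 4 * e₁ * m + m ^ 2) := by
  unfold stringForm
  ring

set_option maxHeartbeats 4000000 in
-- The coefficients in the series solve the scaled string equation order by order: everything below
-- `w ^ 16` cancels, and the witness is the explicit polynomial quotient of the remainder by `w ^
-- 16`.
theorem exists_stringForm_profileTaylor_eq (t : ℝ) : ∃ r : ℝ → ℝ, Continuous r ∧ ∀ w : ℝ,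
    stringForm (profileTaylor t w (-2 * w ^ 3 / 60)) (profileTaylor t w (-1 * w ^ 3 / 60))
      (profileTaylor t w 0) (profileTaylor t w (1 * w ^ 3 / 60))
      (profileTaylor t w (2 * w ^ 3 / 60)) - t / 3 * w ^ 2 * profileTaylor t w 0 - 10 =
      w ^ 16 * r w := by
  refine ⟨fun w =>
    173 / 2834352000000 * t ^ 2 + 1 / 398580750000 * t ^ 5 - 1067 / 612220032000000 * w ^ 2
      + 509 / 3443737680000000 * t ^ 3 * w ^ 2 + 73 / 3874204890000000 * t ^ 6 * w ^ 2
      + 77 / 1046035320300000000 * t ^ 9 * w ^ 2 - 7 / 1101996057600000 * t * w ^ 4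
      - 1139 / 206624260800000000 * t ^ 4 * w ^ 4 - 191 / 1394713760400000000 * t ^ 7 * w ^ 4
      - 1 / 3486784401000000000 * t ^ 10 * w ^ 4 + 6029 / 2479491129600000000 * t ^ 2 * w ^ 6
      + 241 / 2231542016640000000 * t ^ 5 * w ^ 6 - 1 / 3138105960900000000 * t ^ 8 * w ^ 6
      - 1 / 313810596090000000000 * t ^ 11 * w ^ 6 - 19327 / 79343716147200000000 * w ^ 8
      - 1571 / 20920706406000000000 * t ^ 3 * w ^ 8 - 47 / 235357947067500000000 * t ^ 6 * w ^ 8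
      + 1463 / 67783088755440000000000 * t ^ 9 * w ^ 8
      + 43 / 762559748498700000000000 * t ^ 12 * w ^ 8
      + 264671 / 21422803359744000000000 * t * w ^ 10
      - 257 / 24100653779712000000000 * t ^ 4 * w ^ 10
      - 15239 / 451887258369600000000000 * t ^ 7 * w ^ 10
      - 517 / 3050238993994800000000000 * t ^ 10 * w ^ 10
      - 11 / 68630377364883000000000000 * t ^ 13 * w ^ 10
      - 193909 / 1071140167987200000000000 * t ^ 2 * w ^ 12
      + 22621 / 723019613391360000000000 * t ^ 5 * w ^ 12
      + 24787 / 61004779879896000000000000 * t ^ 8 * w ^ 12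
      - 1169 / 549043018919064000000000000 * t ^ 11 * w ^ 12
      - 29 / 6176733962839470000000000000 * t ^ 14 * w ^ 12
      + 13601 / 2142280335974400000000000 * w ^ 14
      - 8043787 / 867623536069632000000000000 * t ^ 3 * w ^ 14
      - 381053 / 1464114717117504000000000000 * t ^ 6 * w ^ 14
      + 317579 / 32942581135143840000000000000 * t ^ 9 * w ^ 14
      + 67 / 1482416151081472800000000000 * t ^ 12 * w ^ 14
      + 37 / 833859084983328450000000000000 * t ^ 15 * w ^ 14
      + 1087769 / 2313662762852352000000000000 * t * w ^ 16
      + 10003697 / 234258354738800640000000000000 * t ^ 4 * w ^ 16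
      - 438253 / 65885162270287680000000000000 * t ^ 7 * w ^ 16
      - 166543 / 5929664604325891200000000000000 * t ^ 10 * w ^ 16
      + 4973 / 13341745359733255200000000000000 * t ^ 13 * w ^ 16
      + 7 / 18761829412124890125000000000000 * t ^ 16 * w ^ 16
      - 6580823 / 624688945970135040000000000000 * t ^ 2 * w ^ 18
      + 31100987 / 21083251926492057600000000000000 * t ^ 5 * w ^ 18
      + 201739 / 3162487788973808640000000000000 * t ^ 8 * w ^ 18
      - 180487 / 533669814389330208000000000000000 * t ^ 11 * w ^ 18
      - 1483 / 400252360791997656000000000000000 * t ^ 14 * w ^ 18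
      - 13 / 2701703435345984178000000000000000 * t ^ 17 * w ^ 18
      + 201179 / 520574121641779200000000000000 * w ^ 20
      - 803503 / 9370334189552025600000000000000 * t ^ 3 * w ^ 20
      - 90587723 / 1897492673384285184000000000000000 * t ^ 6 * w ^ 20
      + 198899 / 12808075545343924992000000000000000 * t ^ 9 * w ^ 20
      + 146933 / 18011356235639894520000000000000000 * t ^ 12 * w ^ 20
      + 3043 / 324204412241518101360000000000000000 * t ^ 15 * w ^ 20
      + 161 / 10941898913151235920900000000000000000 * t ^ 18 * w ^ 20
      - 5911307 / 281110025686560768000000000000000 * t * w ^ 22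
      + 39375611 / 3794985346768570368000000000000000 * t ^ 4 * w ^ 22
      + 24770341 / 64040377726719624960000000000000000 * t ^ 7 * w ^ 22
      - 3433253 / 288181699770238312320000000000000000 * t ^ 10 * w ^ 22
      - 77953 / 1621022061207590506800000000000000000 * t ^ 13 * w ^ 22
      + 77 / 291783971017366291224000000000000000 * t ^ 16 * w ^ 22
      + 1 / 4103212092431713470337500000000000000 * t ^ 19 * w ^ 22
      - 2543873 / 3373320308238729216000000000000000 * t ^ 2 * w ^ 24
      - 2639177 / 13661947248366853324800000000000000 * t ^ 5 * w ^ 24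
      + 5388797 / 1152726799080953249280000000000000000 * t ^ 8 * w ^ 24
      + 665791 / 5187270595864289621760000000000000000 * t ^ 11 * w ^ 24
      - 14879 / 29178397101736629122400000000000000000 * t ^ 14 * w ^ 24
      - 419 / 131302786957814831050800000000000000000 * t ^ 17 * w ^ 24
      - 1 / 295431270655083369864300000000000000000 * t ^ 20 * w ^ 24
      - 65219 / 8433300770596823040000000000000000 * w ^ 26
      + 87326963 / 3643185932897827553280000000000000000 * t ^ 3 * w ^ 26
      - 9597401 / 40985841745100559974400000000000000000 * t ^ 6 * w ^ 26
      - 10129243 / 103745411917285792435200000000000000000 * t ^ 9 * w ^ 26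
      + 1650389 / 9337087072555721319168000000000000000000 * t ^ 12 * w ^ 26
      + 64487 / 7878167217468889863048000000000000000000 * t ^ 15 * w ^ 26
      + 2381 / 709035049572200087674320000000000000000000 * t ^ 18 * w ^ 26
      + 1 / 63813154461498007890688800000000000000000 * t ^ 21 * w ^ 26
      - 183799 / 607197655482971258880000000000000000 * t * w ^ 28
      + 151613 / 12295752523530167992320000000000000000 * t ^ 4 * w ^ 28
      + 4272389 / 207490823834571584870400000000000000000 * t ^ 7 * w ^ 28
      + 18997 / 2801126121766716395750400000000000000000 * t ^ 10 * w ^ 28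
      - 63283 / 15756334434937779726096000000000000000000 * t ^ 13 * w ^ 28
      + 121 / 70903504957220008767432000000000000000000 * t ^ 16 * w ^ 28
      + 121 / 797664430768725098633610000000000000000000 * t ^ 19 * w ^ 28, by fun_prop, fun w => ?_⟩
  have e0 : profileTaylor t w 0 = profileEven t w 0 := by
    unfold profileTaylor profileEven
    ring
  rw [show -2 * w ^ 3 / 60 = -(2 * w ^ 3 / 60) by ring,
    show -1 * w ^ 3 / 60 = -(1 * w ^ 3 / 60) by ring, profileTaylor_neg, profileTaylor_neg,
    profileTaylor_eq t w (1 * w ^ 3 / 60), profileTaylor_eq t w (2 * w ^ 3 / 60), e0,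
    stringForm_symmetric]
  unfold profileEven profileOdd
  ring

theorem profile_tendsto (t j : ℝ) :
    Tendsto (fun w : ℝ => profile t w (j * w ^ 3 / 60)) (𝓝 0) (𝓝 1) := by
  have h1 : ContinuousAt (fun w : ℝ => 1 + j * w ^ 3 / 60) 0 := by fun_prop
  have h : ∀ a : ℝ, ContinuousAt (fun w : ℝ => (1 + j * w ^ 3 / 60) ^ a) 0 := fun a =>
    h1.rpow_const (Or.inl (by norm_num))
  have hc : ContinuousAt (fun w : ℝ => profile t w (j * w ^ 3 / 60)) 0 := by
    unfold profile
    have a1 := h (1 / 3)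
    have a2 := h (-(1 / 3))
    have a3 := h (-(5 / 3))
    have a4 := h (-(7 / 3))
    have a5 := h (-3)
    have a6 := h (-(11 / 3))
    have a7 := h (-(13 / 3))
    fun_prop
  simpa [ContinuousAt, profile] using hc

/-- By `stringForm_sub`, replacing `profileTaylor` by `profile` changes the form by bounded
multiples of `O(w ^ 16)` differences. -/
theorem stringForm_profile_isBigO (t : ℝ) :
    (fun w : ℝ => stringForm (profile t w (-2 * w ^ 3 / 60)) (profile t w (-1 * w ^ 3 / 60))
      (profile t w 0) (profile t w (1 * w ^ 3 / 60))
      (profile t w (2 * w ^ 3 / 60)) - t / 3 * w ^ 2 * profile t w 0 - 10)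
      =O[𝓝 0] fun w => w ^ 16 := by
  obtain ⟨r, hr, hrem⟩ := exists_stringForm_profileTaylor_eq t
  have hO := profile_sub_taylor_isBigO t
  have b : ∀ j, Tendsto (fun w => profile t w (j * w ^ 3 / 60)) (𝓝 0) (𝓝 1) := profile_tendsto t
  have b' : ∀ j, Continuous (fun w => profileTaylor t w (j * w ^ 3 / 60)) := fun j => by
    unfold profileTaylor
    fun_prop
  have O0 : (fun w => profile t w 0 - profileTaylor t w 0) =O[𝓝 0] fun w => w ^ 16 := by
    simpa using hO 0
  have b0 : Tendsto (fun w => profile t w 0) (𝓝 0) (𝓝 1) := by simpa using b 0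
  have b0' : Continuous (fun w => profileTaylor t w 0) := by simpa using b' 0
  have one : ∀ {f : ℝ → ℝ} {x : ℝ}, Tendsto f (𝓝 0) (𝓝 x) → f =O[𝓝 0] fun _ => (1 : ℝ) :=
    fun h => h.isBigO_one ℝ
  have T := fun j => (b' j).tendsto 0
  have T0 := b0'.tendsto 0
  have c1 := one (b0.mul (b (-1)))
  have c2 := one (b0.mul ((((T (-2)).add (b (-1))).add (T (-1))).add (b0.const_mul 2) |>.add (b 1)))
  have c3 := one ((((((((T (-2)).mul (T (-1))).add ((T (-1)).pow 2)).add
    ((T (-1)).mul (T 1))).add ((T 1).pow 2)).add ((T 1).mul (T 2))).add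
    ((((T (-1)).add (T 1)).const_mul 2).mul (b0.add T0))).add (b0.pow 2) |>.add
      (b0.mul T0) |>.add (T0.pow 2))
  have c4 := one (b0.mul ((((T (-1)).add (b0.const_mul 2)).add (b 1)).add (T 1) |>.add (b 2)))
  have c5 := one (b0.mul (T 1))
  have c6 : (fun w : ℝ => t / 3 * w ^ 2) =O[𝓝 0] fun _ => (1 : ℝ) :=
    one (Continuous.tendsto (by fun_prop) 0)
  have c7 := one (hr.tendsto 0)
  refine ((((((c1.mul (hO (-2))).add (c2.mul (hO (-1)))).add (c3.mul O0)).add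
    (c4.mul (hO 1))).add (c5.mul (hO 2))).sub (c6.mul O0) |>.add
      (c7.mul (Asymptotics.isBigO_refl (fun w : ℝ => w ^ 16) (𝓝 0)))).congr ?_ ?_
  · intro w
    have := stringForm_sub (profile t w (-2 * w ^ 3 / 60)) (profile t w (-1 * w ^ 3 / 60))
      (profile t w 0) (profile t w (1 * w ^ 3 / 60)) (profile t w (2 * w ^ 3 / 60))
      (profileTaylor t w (-2 * w ^ 3 / 60)) (profileTaylor t w (-1 * w ^ 3 / 60))
      (profileTaylor t w 0) (profileTaylor t w (1 * w ^ 3 / 60))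
      (profileTaylor t w (2 * w ^ 3 / 60))
    have h2 := hrem w
    linear_combination -this - h2
  · intro w
    ring

/-! ### The truncated series in scaled variables. -/

/-- The truncated asymptotic series of the recurrence coefficients. -/
def truncatedSeries (t x : ℝ) : ℝ :=
  x ^ (1 / 3 : ℝ) / (60 : ℝ) ^ (1 / 3 : ℝ)
    + t / (3 * (450 : ℝ) ^ (1 / 3 : ℝ) * x ^ (1 / 3 : ℝ))
    - (4 * t ^ 3 - 135) / (2430 * (60 : ℝ) ^ (1 / 3 : ℝ) * x ^ (5 / 3 : ℝ))
    + t * (2 * t ^ 3 - 45) / (3645 * (450 : ℝ) ^ (1 / 3 : ℝ) * x ^ (7 / 3 : ℝ))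
    - 2 * t ^ 2 / (1215 * x ^ 3)
    - (16 * t ^ 6 - 3780 * t ^ 3 + 40095) /
        (1476225 * (60 : ℝ) ^ (1 / 3 : ℝ) * x ^ (11 / 3 : ℝ))
    + t * (16 * t ^ 6 - 180 * t ^ 3 - 112995) /
        (3542940 * (450 : ℝ) ^ (1 / 3 : ℝ) * x ^ (13 / 3 : ℝ))

theorem truncatedSeries_eq_mul_profile (t : ℝ) {z u : ℝ} (hz : 0 < z) (hu : 0 < 1 + u) :
    truncatedSeries t (60 * z ^ 3 * (1 + u)) = z * profile t z⁻¹ u := by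
  obtain ⟨c, hc⟩ : ∃ c : ℝ, c = (60 : ℝ) ^ (1 / 3 : ℝ) := ⟨_, rfl⟩
  have hc0 : 0 < c := by rw [hc]; positivity
  have hc3 : c ^ 3 = 60 := by
    rw [hc, ← Real.rpow_natCast, ← Real.rpow_mul (by norm_num)]
    norm_num
  -- Since `60 ^ 2 / 8 = 450`, both cube roots are expressed through `c`; every denominator then
  -- carries a power of `c ^ 3 = 60`.
  have h450 : (450 : ℝ) ^ (1 / 3 : ℝ) = c ^ 2 / 2 := by
    have : (450 : ℝ) = (c ^ 2 / 2) ^ (3 : ℝ) := by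
      rw [show (3 : ℝ) = ((3 : ℕ) : ℝ) by norm_num, Real.rpow_natCast]
      linear_combination (-(c ^ 3 + 60) / 8) * hc3
    rw [this, ← Real.rpow_mul (by positivity)]
    norm_num
  obtain ⟨v, hv⟩ : ∃ v : ℝ, v = (1 + u) ^ (1 / 3 : ℝ) := ⟨_, rfl⟩
  have hv0 : 0 < v := by rw [hv]; positivity
  have hvk : ∀ k : ℕ, (1 + u) ^ ((k : ℝ) / 3) = v ^ k := fun k => by
    rw [hv, ← Real.rpow_natCast, ← Real.rpow_mul hu.le]
    congr 1
    ring
  have hxk : ∀ k : ℕ, (60 * z ^ 3 * (1 + u)) ^ ((k : ℝ) / 3) = (c * z * v) ^ k := fun k => by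
    have e : 60 * z ^ 3 * (1 + u) = (c * z * v) ^ (3 : ℝ) := by
      rw [show (3 : ℝ) = ((3 : ℕ) : ℝ) by norm_num, Real.rpow_natCast, mul_pow, mul_pow, hc3,
        ← hvk 3]
      norm_num
    rw [e, ← Real.rpow_mul (by positivity), ← Real.rpow_natCast]
    congr 1
    ring
  have x1 := hxk 1
  have x5 := hxk 5
  have x7 := hxk 7
  have x9 := hxk 9
  have x11 := hxk 11
  have x13 := hxk 13
  have v1 := hvk 1
  have v5 := hvk 5
  have v7 := hvk 7
  have v9 := hvk 9
  have v11 := hvk 11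
  have v13 := hvk 13
  rw [show ((9 : ℕ) : ℝ) / 3 = ((3 : ℕ) : ℝ) by norm_num, Real.rpow_natCast] at x9
  rw [show ((9 : ℕ) : ℝ) / 3 = 3 by norm_num] at v9
  push_cast at x1 x5 x7 x11 x13 v1 v5 v7 v11 v13
  unfold truncatedSeries profile
  simp only [Real.rpow_neg hu.le]
  rw [x1, x5, x7, x9, x11, x13, v1, v5, v7, v9, v11, v13, h450, ← hc]
  have p6 : c ^ 6 = 60 ^ 2 := by rw [← hc3]; ring
  have p9 : c ^ 9 = 60 ^ 3 := by rw [← hc3]; ring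
  have p12 : c ^ 12 = 60 ^ 4 := by rw [← hc3]; ring
  have p15 : c ^ 15 = 60 ^ 5 := by rw [← hc3]; ring
  have f1 : (c * z * v) ^ 1 / c = z * v := by field_simp
  have f2 : 3 * (c ^ 2 / 2) * (c * z * v) ^ 1 = 90 * (z * v) := by
    linear_combination (3 / 2 * z * v) * hc3
  have f3 : 2430 * c * (c * z * v) ^ 5 = 2430 * 60 ^ 2 * (z * v) ^ 5 := by
    linear_combination (2430 * (z * v) ^ 5) * p6
  have f4 : 3645 * (c ^ 2 / 2) * (c * z * v) ^ 7 = 3645 / 2 * 60 ^ 3 * (z * v) ^ 7 := by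
    linear_combination (3645 / 2 * (z * v) ^ 7) * p9
  have f5 : 1215 * (c * z * v) ^ 9 = 1215 * 60 ^ 3 * (z * v) ^ 9 := by
    linear_combination (1215 * (z * v) ^ 9) * p9
  have f6 : 1476225 * c * (c * z * v) ^ 11 = 1476225 * 60 ^ 4 * (z * v) ^ 11 := by
    linear_combination (1476225 * (z * v) ^ 11) * p12
  have f7 : 3542940 * (c ^ 2 / 2) * (c * z * v) ^ 13 = 3542940 / 2 * 60 ^ 5 * (z * v) ^ 13 := by
    linear_combination (3542940 / 2 * (z * v) ^ 13) * p15
  rw [f1, f2, f3, f4, f5, f6, f7]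
  field_simp
  ring

/-- The leading term `(n / 60) ^ (1 / 3)` of the recurrence coefficients. -/
def leadingTerm (n : ℕ) : ℝ := ((n : ℝ) / 60) ^ (1 / 3 : ℝ)

theorem leadingTerm_pos {n : ℕ} (hn : 0 < n) : 0 < leadingTerm n := by
  unfold leadingTerm
  positivity

theorem leadingTerm_pow_three (n : ℕ) : 60 * leadingTerm n ^ 3 = n := by
  rw [leadingTerm, ← Real.rpow_natCast, ← Real.rpow_mul (by positivity)]
  norm_num
  ring

theorem leadingTerm_inv_tendsto : Tendsto (fun n => (leadingTerm n)⁻¹) atTop (𝓝 0) := by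
  refine tendsto_inv_atTop_zero.comp ?_
  exact (tendsto_rpow_atTop (by norm_num : (0 : ℝ) < 1 / 3)).comp
    (tendsto_natCast_atTop_atTop.atTop_div_const (by norm_num))

theorem leadingTerm_ratio_tendsto (i j : ℕ) :
    Tendsto (fun k => leadingTerm (k + i) / leadingTerm (k + j)) atTop (𝓝 1) := by
  have h1 : Tendsto (fun k : ℕ => (((k + i : ℕ) : ℝ) / ((k + j : ℕ) : ℝ))) atTop (𝓝 1) := by
    have h2 : Tendsto (fun k : ℕ => 1 + ((i : ℝ) - j) / ((k + j : ℕ) : ℝ)) atTop (𝓝 (1 + 0)) :=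
      (tendsto_const_nhds.div_atTop
        (tendsto_natCast_atTop_atTop.comp (tendsto_add_atTop_nat j))).const_add 1
    rw [add_zero] at h2
    refine h2.congr' ?_
    filter_upwards [eventually_gt_atTop 0] with k hk
    have : ((k + j : ℕ) : ℝ) ≠ 0 := by positivity
    rw [eq_div_iff this, add_mul, div_mul_cancel₀ _ this]
    push_cast
    ring
  have h3 := h1.rpow_const (p := 1 / 3) (Or.inl one_ne_zero)
  rw [Real.one_rpow] at h3
  refine h3.congr fun k => ?_
  rw [leadingTerm, leadingTerm, ← Real.div_rpow (by positivity) (by positivity)]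
  congr 1
  exact (div_div_div_cancel_right₀ (by norm_num) _ _).symm

/-- The truncated series at a shifted index in terms of the profile at the base index. -/
theorem truncatedSeries_div_leadingTerm (t : ℝ) {n m : ℕ} (hn : 0 < n) (hm : 0 < m) (j : ℝ)
    (hj : (m : ℝ) = n + j) : truncatedSeries t m / leadingTerm n =
      profile t (leadingTerm n)⁻¹ (j * (leadingTerm n)⁻¹ ^ 3 / 60) := by
  have hz := leadingTerm_pos hn
  have h3 := leadingTerm_pow_three n
  have hm' : (0 : ℝ) < m := by exact_mod_cast hm
  generalize leadingTerm n = z at *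
  have e : (m : ℝ) = 60 * z ^ 3 * (1 + j * z⁻¹ ^ 3 / 60) := by
    rw [hj, ← h3]
    field_simp
  have hpos : 0 < 1 + j * z⁻¹ ^ 3 / 60 := by
    rw [e] at hm'
    exact pos_of_mul_pos_right hm' (by positivity)
  rw [e, truncatedSeries_eq_mul_profile t hz hpos]
  field_simp

/-! ### The scaled string equation and the error estimate. -/

theorem stringForm_div (a b m d e z : ℝ) :
    stringForm (a / z) (b / z) (m / z) (d / z) (e / z) = stringForm a b m d e / z ^ 3 := by
  unfold stringForm
  ring

theorem IsRecurrenceCoeff.stringForm_eq {t : ℝ} {P : ℕ → ℝ[X]} {β : ℕ → ℝ}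
    (hP : IsMonicOPS t P) (hβ : IsRecurrenceCoeff P β) (k : ℕ) {z : ℝ}
    (hz : z = leadingTerm (k + 3)) :
    stringForm (β (k + 1) / z) (β (k + 2) / z) (β (k + 3) / z) (β (k + 4) / z) (β (k + 5) / z)
      - t / 3 * z⁻¹ ^ 2 * (β (k + 3) / z) = 10 := by
  have hs := hβ.string_equation hP k
  have h3 := leadingTerm_pow_three (k + 3)
  have hz0 := leadingTerm_pos (show 0 < k + 3 by omega)
  rw [← hz] at h3 hz0
  push_cast at h3
  rw [stringForm_div, show t / 3 * z⁻¹ ^ 2 * (β (k + 3) / z) = t / 3 * β (k + 3) / z ^ 3 by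
    field_simp, ← sub_div, div_eq_iff (by positivity)]
  unfold stringForm
  linear_combination hs / 6 - h3 / 6

theorem IsRecurrenceCoeff.div_leadingTerm_tendsto {t : ℝ} {P : ℕ → ℝ[X]} {β : ℕ → ℝ}
    (hP : IsMonicOPS t P) (hβ : IsRecurrenceCoeff P β) :
    Tendsto (fun n => β n / leadingTerm n) atTop (𝓝 1) := by
  have hη : Tendsto (fun k => t / 3 * (leadingTerm (k + 3))⁻¹ ^ 2) atTop (𝓝 0) := by
    have := ((leadingTerm_inv_tendsto.comp (tendsto_add_atTop_nat 3)).pow 2).const_mul (t / 3)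
    simpa using this
  have hnn : ∀ n, 0 ≤ β n / leadingTerm n := by
    intro n
    cases n with
    | zero => simp [hβ.coeff_zero]
    | succ n => exact (div_pos (hβ.succ_pos hP n) (leadingTerm_pos n.succ_pos)).le
  refine tendsto_one_of_stringForm hnn hη (leadingTerm_ratio_tendsto 1 3)
    (leadingTerm_ratio_tendsto 2 3) (leadingTerm_ratio_tendsto 4 3)
    (leadingTerm_ratio_tendsto 5 3) fun k => ?_
  -- The ratios `σ` convert each term's own normalization to the central one, `leadingTerm (k + 3)`.
  have hz : ∀ j, leadingTerm (k + (j + 1)) ≠ 0 := fun j => (leadingTerm_pos (by omega)).ne'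
  rw [div_mul_div_cancel₀ (hz 0), div_mul_div_cancel₀ (hz 1), div_mul_div_cancel₀ (hz 3),
    div_mul_div_cancel₀ (hz 4)]
  exact hβ.stringForm_eq hP k rfl

/-- Diagonal dominance with slack around the limits `1, 6, 16, 6, 1`: the neighbours contribute at
most `2 * (11 / 10 + 61 / 10) = 72 / 5`, and `(72 / 5) / 15 = 24 / 25`. -/
theorem abs_le_of_dominant_coeff {a₁ a₂ a₃ a₄ a₅ r₁ r₂ r₄ r₅ d₁ d₂ d₃ d₄ d₅ ρ M : ℝ}
    (h₁ : |a₁ * r₁| < 11 / 10) (h₂ : |a₂ * r₂| < 61 / 10) (h₃ : 15 < a₃)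
    (h₄ : |a₄ * r₄| < 61 / 10) (h₅ : |a₅ * r₅| < 11 / 10) (m₁ : |d₁| ≤ M) (m₂ : |d₂| ≤ M)
    (m₄ : |d₄| ≤ M) (m₅ : |d₅| ≤ M)
    (h : a₃ * d₃ = -(a₁ * (d₁ * r₁) + a₂ * (d₂ * r₂) + a₄ * (d₄ * r₄) + a₅ * (d₅ * r₅)) - ρ) :
    |d₃| ≤ 24 / 25 * M + |ρ| / 15 := by
  have hM : 0 ≤ M := (abs_nonneg _).trans m₁
  have b : ∀ {a r d y : ℝ}, |a * r| < y → |d| ≤ M → |a * (d * r)| ≤ y * M := by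
    intro a r d y h1 h2
    rw [show a * (d * r) = a * r * d by ring, abs_mul]
    exact mul_le_mul h1.le h2 (abs_nonneg _) ((abs_nonneg _).trans h1.le)
  have b₁ := abs_le.1 (b h₁ m₁)
  have b₂ := abs_le.1 (b h₂ m₂)
  have b₄ := abs_le.1 (b h₄ m₄)
  have b₅ := abs_le.1 (b h₅ m₅)
  have b₃ : |a₃ * d₃| ≤ 72 / 5 * M + |ρ| := by
    rw [h, abs_le]
    constructor <;> linarith [le_abs_self ρ, neg_abs_le ρ]
  rw [abs_mul, abs_of_pos (by linarith)] at b₃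
  linarith [mul_le_mul_of_nonneg_right h₃.le (abs_nonneg d₃)]

theorem IsRecurrenceCoeff.relative_error_isBigO {t : ℝ} {P : ℕ → ℝ[X]} {β : ℕ → ℝ}
    (hP : IsMonicOPS t P) (hβ : IsRecurrenceCoeff P β) :
    (fun n => |β n - truncatedSeries t n| / leadingTerm n) =O[atTop]
      fun n => (leadingTerm n)⁻¹ ^ 16 := by
  have hw3 : Tendsto (fun k => (leadingTerm (k + 3))⁻¹) atTop (𝓝 0) :=
    leadingTerm_inv_tendsto.comp (tendsto_add_atTop_nat 3)
  have hx : ∀ i, Tendsto (fun k => β (k + (i + 1)) / leadingTerm (k + 3)) atTop (𝓝 1) := by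
    intro i
    have := ((hβ.div_leadingTerm_tendsto hP).comp (tendsto_add_atTop_nat (i + 1))).mul
      (leadingTerm_ratio_tendsto (i + 1) 3)
    rw [one_mul] at this
    refine this.congr fun k => ?_
    exact div_mul_div_cancel₀ (leadingTerm_pos (show 0 < k + (i + 1) by omega)).ne'
  have hv : ∀ i, Tendsto (fun k => truncatedSeries t (k + (i + 1) : ℕ) / leadingTerm (k + 3))
      atTop (𝓝 1) := by
    intro i
    refine ((profile_tendsto t ((i : ℝ) - 2)).comp hw3).congr fun k => ?_
    rw [truncatedSeries_div_leadingTerm t (by omega) (by omega) ((i : ℝ) - 2)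
      (by push_cast; ring)]
    rfl
  obtain ⟨R, hR⟩ := ((stringForm_profile_isBigO t).comp_tendsto hw3).bound
  have hσ := fun i => leadingTerm_ratio_tendsto (i + 1) 3
  -- The coefficients of the linearized string equation tend to `1, 6, 16, 6, 1`.
  have c1 : Tendsto (fun k => β (k + 3) / leadingTerm (k + 3) * (β (k + 2) / leadingTerm (k + 3))
      * (leadingTerm (k + 1) / leadingTerm (k + 3))) atTop (𝓝 1) := by
    simpa using ((hx 2).mul (hx 1)).mul (hσ 0)
  have c2 : Tendsto (fun k => β (k + 3) / leadingTerm (k + 3) *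
      (truncatedSeries t (k + 1 : ℕ) / leadingTerm (k + 3) + β (k + 2) / leadingTerm (k + 3) +
        truncatedSeries t (k + 2 : ℕ) / leadingTerm (k + 3) +
        2 * (β (k + 3) / leadingTerm (k + 3)) + β (k + 4) / leadingTerm (k + 3))
      * (leadingTerm (k + 2) / leadingTerm (k + 3))) atTop (𝓝 6) := by
    have := ((hx 2).mul (((((hv 0).add (hx 1)).add (hv 1)).add ((hx 2).const_mul 2)).add
      (hx 3))).mul (hσ 1)
    norm_num at this ⊢
    exact this
  have c3 : Tendsto (fun k =>
      (truncatedSeries t (k + 1 : ℕ) / leadingTerm (k + 3)) *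
        (truncatedSeries t (k + 2 : ℕ) / leadingTerm (k + 3)) +
      (truncatedSeries t (k + 2 : ℕ) / leadingTerm (k + 3)) ^ 2 +
      (truncatedSeries t (k + 2 : ℕ) / leadingTerm (k + 3)) *
        (truncatedSeries t (k + 4 : ℕ) / leadingTerm (k + 3)) +
      (truncatedSeries t (k + 4 : ℕ) / leadingTerm (k + 3)) ^ 2 +
      (truncatedSeries t (k + 4 : ℕ) / leadingTerm (k + 3)) *
        (truncatedSeries t (k + 5 : ℕ) / leadingTerm (k + 3)) +
      2 * (truncatedSeries t (k + 2 : ℕ) / leadingTerm (k + 3) +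
          truncatedSeries t (k + 4 : ℕ) / leadingTerm (k + 3)) *
        (β (k + 3) / leadingTerm (k + 3) + truncatedSeries t (k + 3 : ℕ) / leadingTerm (k + 3)) +
      (β (k + 3) / leadingTerm (k + 3)) ^ 2 +
      β (k + 3) / leadingTerm (k + 3) * (truncatedSeries t (k + 3 : ℕ) / leadingTerm (k + 3)) +
      (truncatedSeries t (k + 3 : ℕ) / leadingTerm (k + 3)) ^ 2 -
      t / 3 * (leadingTerm (k + 3))⁻¹ ^ 2) atTop (𝓝 16) := by
    have := (((((((((((hv 0).mul (hv 1)).add ((hv 1).pow 2)).add ((hv 1).mul (hv 3))).add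
      ((hv 3).pow 2)).add ((hv 3).mul (hv 4))).add
      ((((hv 1).add (hv 3)).const_mul 2).mul ((hx 2).add (hv 2)))).add ((hx 2).pow 2)).add
      ((hx 2).mul (hv 2))).add ((hv 2).pow 2)).sub ((hw3.pow 2).const_mul (t / 3)))
    norm_num at this ⊢
    exact this
  have c4 : Tendsto (fun k => β (k + 3) / leadingTerm (k + 3) *
      (truncatedSeries t (k + 2 : ℕ) / leadingTerm (k + 3) +
        2 * (β (k + 3) / leadingTerm (k + 3)) + β (k + 4) / leadingTerm (k + 3) +
        truncatedSeries t (k + 4 : ℕ) / leadingTerm (k + 3) + β (k + 5) / leadingTerm (k + 3))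
      * (leadingTerm (k + 4) / leadingTerm (k + 3))) atTop (𝓝 6) := by
    have := ((hx 2).mul (((((hv 1).add ((hx 2).const_mul 2)).add (hx 3)).add (hv 3)).add
      (hx 4))).mul (hσ 3)
    norm_num at this ⊢
    exact this
  have c5 : Tendsto (fun k => β (k + 3) / leadingTerm (k + 3) *
      (truncatedSeries t (k + 4 : ℕ) / leadingTerm (k + 3))
      * (leadingTerm (k + 5) / leadingTerm (k + 3))) atTop (𝓝 1) := by
    simpa using ((hx 2).mul (hv 3)).mul (hσ 4)
  have habs : ∀ {f : ℕ → ℝ} {x : ℝ} (y : ℝ), Tendsto f atTop (𝓝 x) → |x| < y →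
      ∀ᶠ k in atTop, |f k| < y := fun y h hy => h.abs.eventually (gt_mem_nhds hy)
  have hstep : ∀ᶠ k in atTop, ∀ M,
      |β (k + 1) - truncatedSeries t (k + 1 : ℕ)| / leadingTerm (k + 1) ≤ M →
      |β (k + 2) - truncatedSeries t (k + 2 : ℕ)| / leadingTerm (k + 2) ≤ M →
      |β (k + 4) - truncatedSeries t (k + 4 : ℕ)| / leadingTerm (k + 4) ≤ M →
      |β (k + 5) - truncatedSeries t (k + 5 : ℕ)| / leadingTerm (k + 5) ≤ M →
      |β (k + 3) - truncatedSeries t (k + 3 : ℕ)| / leadingTerm (k + 3) ≤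
        24 / 25 * M + |R| / 15 * (leadingTerm (k + 3))⁻¹ ^ 16 := by
    filter_upwards [habs (11 / 10) c1 (by norm_num), habs (61 / 10) c2 (by norm_num),
      c3.eventually (lt_mem_nhds (show (15 : ℝ) < 16 by norm_num)),
      habs (61 / 10) c4 (by norm_num), habs (11 / 10) c5 (by norm_num), hR]
      with k k1 k2 k3 k4 k5 kR M m1 m2 m4 m5
    have hpos : ∀ j, 0 < leadingTerm (k + (j + 1)) := fun j => leadingTerm_pos (by omega)
    have p1 := hpos 0
    have p2 := hpos 1
    have p3 := hpos 2
    have p4 := hpos 3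
    have p5 := hpos 4
    norm_num only at p1 p2 p3 p4 p5
    have hs := hβ.stringForm_eq hP k rfl
    have ser : ∀ (i : ℕ) (j : ℝ), (i : ℝ) + 1 = 3 + j →
        profile t (leadingTerm (k + 3))⁻¹ (j * (leadingTerm (k + 3))⁻¹ ^ 3 / 60) =
          truncatedSeries t (k + (i + 1) : ℕ) / leadingTerm (k + 3) := fun i j hj =>
      (truncatedSeries_div_leadingTerm t (by omega) (by omega) j
        (by push_cast; linear_combination hj)).symm
    have s1 := ser 0 (-2) (by norm_num)
    have s2 := ser 1 (-1) (by norm_num)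
    have s3 := ser 2 0 (by norm_num)
    have s4 := ser 3 1 (by norm_num)
    have s5 := ser 4 2 (by norm_num)
    rw [zero_mul, zero_div] at s3
    simp only [Function.comp_apply] at kR
    rw [s1, s2, s3, s4, s5, norm_pow, Real.norm_eq_abs, Real.norm_of_nonneg (inv_pos.2 p3).le]
      at kR
    -- Each neighbouring error is measured relative to its own leading term; the ratio left over is
    -- absorbed in `c1`, `c2`, `c4`, `c5`.
    have split : ∀ {x y a b : ℝ}, 0 < a → x / b - y / b = (x - y) / a * (a / b) :=
      fun ha => by rw [div_mul_div_cancel₀ ha.ne', sub_div]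
    have hsub := stringForm_sub (β (k + 1) / leadingTerm (k + 3)) (β (k + 2) / leadingTerm (k + 3))
      (β (k + 3) / leadingTerm (k + 3)) (β (k + 4) / leadingTerm (k + 3))
      (β (k + 5) / leadingTerm (k + 3)) (truncatedSeries t (k + 1 : ℕ) / leadingTerm (k + 3))
      (truncatedSeries t (k + 2 : ℕ) / leadingTerm (k + 3))
      (truncatedSeries t (k + 3 : ℕ) / leadingTerm (k + 3))
      (truncatedSeries t (k + 4 : ℕ) / leadingTerm (k + 3))
      (truncatedSeries t (k + 5 : ℕ) / leadingTerm (k + 3))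
    rw [split (y := truncatedSeries t (k + 1 : ℕ)) p1,
      split (y := truncatedSeries t (k + 2 : ℕ)) p2,
      split (y := truncatedSeries t (k + 4 : ℕ)) p4,
      split (y := truncatedSeries t (k + 5 : ℕ)) p5] at hsub
    have ab : ∀ {x z : ℝ}, 0 < z → |x| / z = |x / z| := fun hz => by
      rw [abs_div, abs_of_pos hz]
    rw [ab p1] at m1
    rw [ab p2] at m2
    rw [ab p4] at m4
    rw [ab p5] at m5
    rw [ab p3]
    rw [sub_div (β (k + 3))]
    refine (abs_le_of_dominant_coeff (ρ := stringForm
      (truncatedSeries t (k + 1 : ℕ) / leadingTerm (k + 3))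
      (truncatedSeries t (k + 2 : ℕ) / leadingTerm (k + 3))
      (truncatedSeries t (k + 3 : ℕ) / leadingTerm (k + 3))
      (truncatedSeries t (k + 4 : ℕ) / leadingTerm (k + 3))
      (truncatedSeries t (k + 5 : ℕ) / leadingTerm (k + 3)) - t / 3 * (leadingTerm (k + 3))⁻¹ ^ 2 *
      (truncatedSeries t (k + 3 : ℕ) / leadingTerm (k + 3)) - 10)
      k1 k2 k3 k4 k5 m1 m2 m4 m5 ?_).trans ?_
    · linear_combination hs - hsub
    · have : R * (leadingTerm (k + 3))⁻¹ ^ 16 ≤ |R| * (leadingTerm (k + 3))⁻¹ ^ 16 := by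
        gcongr
        exact le_abs_self R
      have := kR.trans this
      linarith
  have hbound : ∀ᶠ n in atTop, |β n - truncatedSeries t n| / leadingTerm n ≤ 1 := by
    have h1 : Tendsto (fun n : ℕ => β n / leadingTerm n - profile t (leadingTerm n)⁻¹ 0) atTop
        (𝓝 (1 - 1)) := by
      refine (hβ.div_leadingTerm_tendsto hP).sub ?_
      simpa [Function.comp_def] using (profile_tendsto t 0).comp leadingTerm_inv_tendsto
    filter_upwards [habs 1 h1 (by norm_num), eventually_gt_atTop 0] with n hn hn0
    have h2 := truncatedSeries_div_leadingTerm t hn0 hn0 0 (by ring)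
    rw [zero_mul, zero_div] at h2
    rw [← h2, ← sub_div, abs_div, abs_of_pos (leadingTerm_pos hn0)] at hn
    exact hn.le
  -- The factor `101 / 100` is small enough that its product with the contraction rate `24 / 25`
  -- stays below `1`.
  have hratio : ∀ i, ∀ᶠ k in atTop, (leadingTerm (k + (i + 1)))⁻¹ ^ 16 ≤
      101 / 100 * (leadingTerm (k + 3))⁻¹ ^ 16 := by
    intro i
    have h1 := (leadingTerm_ratio_tendsto 3 (i + 1)).pow 16
    rw [one_pow] at h1
    filter_upwards [h1.eventually (gt_mem_nhds (show (1 : ℝ) < 101 / 100 by norm_num))] with k hk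
    have p3 : 0 < leadingTerm (k + 3) := leadingTerm_pos (by omega)
    calc (leadingTerm (k + (i + 1)))⁻¹ ^ 16 =
        (leadingTerm (k + 3) / leadingTerm (k + (i + 1))) ^ 16 * (leadingTerm (k + 3))⁻¹ ^ 16 := by
          rw [← mul_pow]
          congr 1
          field_simp
      _ ≤ _ := by gcongr
  obtain ⟨N, hN⟩ := eventually_atTop.1 (hstep.and (hbound.and ((hratio 0).and ((hratio 1).and
    ((hratio 3).and ((hratio 4).and (eventually_gt_atTop 0)))))))
  refine isBigO_of_neighbour_contraction (N := N) (B := 1) (Cg := |R| / 15) (q := 24 / 25)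
    (θ := 101 / 100) (by norm_num) (by norm_num) (by positivity) ?_ (fun n hn => (hN n hn).2.1)
    ?_ (by norm_num) ?_ (fun k hk => (hN k hk).1)
  · intro n
    have : 0 ≤ leadingTerm n := by unfold leadingTerm; positivity
    positivity
  · intro n hn
    have := leadingTerm_pos (hN n hn).2.2.2.2.2.2
    positivity
  · intro k hk
    obtain ⟨-, -, h1, h2, h4, h5, -⟩ := hN k hk
    exact ⟨h1, h2, h4, h5⟩

end Freud

end

theorem theorem11 (t : ℝ) :
    (fun n : ℕ => Freud.recurrenceCoeff t n -
      ((n : ℝ) ^ (1 / 3 : ℝ) / (60 : ℝ) ^ (1 / 3 : ℝ)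
        + t / (3 * (450 : ℝ) ^ (1 / 3 : ℝ) * (n : ℝ) ^ (1 / 3 : ℝ))
        - (4 * t ^ 3 - 135) / (2430 * (60 : ℝ) ^ (1 / 3 : ℝ) * (n : ℝ) ^ (5 / 3 : ℝ))
        + t * (2 * t ^ 3 - 45) / (3645 * (450 : ℝ) ^ (1 / 3 : ℝ) * (n : ℝ) ^ (7 / 3 : ℝ))
        - 2 * t ^ 2 / (1215 * (n : ℝ) ^ 3)
        - (16 * t ^ 6 - 3780 * t ^ 3 + 40095) /
            (1476225 * (60 : ℝ) ^ (1 / 3 : ℝ) * (n : ℝ) ^ (11 / 3 : ℝ))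
        + t * (16 * t ^ 6 - 180 * t ^ 3 - 112995) /
            (3542940 * (450 : ℝ) ^ (1 / 3 : ℝ) * (n : ℝ) ^ (13 / 3 : ℝ))))
      =O[Filter.atTop] (fun n : ℕ => ((n : ℝ) ^ 5)⁻¹) := by
  have h := (Freud.recurrenceCoeff_isRecurrenceCoeff t).relative_error_isBigO
    (Freud.monicOP_isMonicOPS t)
  obtain ⟨K, hK⟩ := h.bound
  -- With `n = 60 * z ^ 3`, one has `z * z⁻¹ ^ 16 = z⁻¹ ^ 15 = 60 ^ 5 / n ^ 5`.
  refine Asymptotics.IsBigO.of_bound (K * 60 ^ 5) ?_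
  filter_upwards [hK, Filter.eventually_gt_atTop 0] with n hn hn0
  change ‖Freud.recurrenceCoeff t n - Freud.truncatedSeries t n‖ ≤ _
  have hz := Freud.leadingTerm_pos hn0
  have h3 := Freud.leadingTerm_pow_three n
  rw [Real.norm_of_nonneg (by positivity), Real.norm_of_nonneg (by positivity),
    div_le_iff₀ hz] at hn
  rw [Real.norm_eq_abs, Real.norm_of_nonneg (by positivity)]
  refine hn.trans (le_of_eq ?_)
  rw [← h3]
  field_simp
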